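/- Let $m,g,l,\bar q_a>0$. For $I\in\mathbb R$ consider on the cylinder $\mathbb S^1\times\mathbb R\ni(q_u,p_u)$ the constrained acrobot dynamics $$\dot q_u=\frac{(1+I^2p_u^2)p_u+m^2gl^3\bar q_a I\,(2\sin q_u+\sin(q_u+q_a))(1+\cos q_a)}{ml^2(1+I^2p_u^2)(3+2\cos q_a)},\qquad \dot p_u=-mgl\,(2\sin q_u+\sin(q_u+q_a)),$$ where $q_a=\bar q_a\arctan(Ip_u)$, and denote by $x(t,x_0)$ its solution with $x(0,x_0)=x_0$. Let $$E(q_u,p_u)=\frac{p_u^2}{10ml^2}+3mgl(1-\cos q_u),\qquad \bar R=E(\pi,0),$$ $E_R=\{E=R\}$, $E_{[R_1,R_2]}=\{R_1\le E\le R_2\}$ and $\mathcal P_r=\{(q_u,p_u): E(q_u,p_u)>\bar R,\ q_u=0\}$. A solution $x(t,x_0)$ is a *rotation over $[0,\bar t]$* if $x([0,\bar t],x_0)\cap\mathcal P_r$ is a discrete set. It *gains* (resp. *loses*) *energy over $[0,\bar t]$* if the times in $[0,\bar t]$ at which it lies in $\mathcal P_r$ form a finite (possibly empty) sequence $t^1<t^2<\cdots$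 and the sequence $\|x(t^i,x_0)\|$ is strictly increasing (resp. strictly decreasing). Put $C=m^2gl^3\bar q_a$, $$b(r,\theta)=\frac{5C\left(\frac{C}{\bar q_a}\left(18\sin^2\theta+30\cos\theta(1-\cos\theta)\right)-r^2\cos\theta\right)}{|r|\sqrt{r^2-30m^2gl^3(1-\cos\theta)}},\qquad S(r)=\int_0^{2\pi}b(r,\theta)\,d\theta .$$ **Theorem (rotations gaining/losing energy).** Let $\bar R<R_1<R_2$, and suppose that there is $\varepsilon>0$ such that $S(r)\ge\varepsilon$ for all $r\in[(10ml^2R_1)^{1/2},(10ml^2R_2)^{1/2}]$. Then there is $I^\star>0$ such that for each $I\in(0,I^\star]$ (resp. $I\in[-I^\star,0)$) and each $x_0\in E_{[R_1,R_2]}$, the solution $x(t,x_0)$ exists for all $t\in\mathbb R$ and is unique, and there is $\bar t\ge0$ such that $x(\bar t,x_0)\in E_{R_2}$ (resp. $x(\bar t,x_0)\in E_{R_1}$) and $x(t,x_0)$ is a rotation gaining (resp. losing) energy over $[0,\bar t]$. -/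

import Mathlib

/-- Physical parameters of the simplified acrobot (two rods of length `l` with point masses `m`
at the tips, gravity `g`), together with the gain `qbar` of the virtual constraint. -/
structure AcrobotParams where
  m : ℝ
  g : ℝ
  l : ℝ
  qbar : ℝ
  m_pos : 0 < m
  g_pos : 0 < g
  l_pos : 0 < l
  qbar_pos : 0 < qbar

namespace AcrobotParams

/-- States `(q_u, p_u)` of the constrained dynamics: the cylinder `S¹ × ℝ`. -/
abbrev State : Type := Real.Angle × ℝ

/-- The leg angle prescribed by the constraint `q_a = qbar * arctan (I * p_u)`. -/
noncomputable def legAngle (P : AcrobotParams) (I p : ℝ) : ℝ :=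
  P.qbar * Real.arctan (I * p)

/-- Right-hand side of the equation for `q_u` in the constrained dynamics. It is `2π`-periodic
in `q`. -/
noncomputable def qDot (P : AcrobotParams) (I q p : ℝ) : ℝ :=
  ((1 + I ^ 2 * p ^ 2) * p
      + P.m ^ 2 * P.g * P.l ^ 3 * P.qbar * I
        * (2 * Real.sin q + Real.sin (q + P.legAngle I p)) * (1 + Real.cos (P.legAngle I p)))
    / (P.m * P.l ^ 2 * (1 + I ^ 2 * p ^ 2) * (3 + 2 * Real.cos (P.legAngle I p)))

/-- Right-hand side of the equation for `p_u` in the constrained dynamics. It is `2π`-periodic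
in `q`. -/
noncomputable def pDot (P : AcrobotParams) (I q p : ℝ) : ℝ :=
  -(P.m * P.g * P.l * (2 * Real.sin q + Real.sin (q + P.legAngle I p)))

/-- `x` is a solution, defined for all times, of the constrained dynamics on the cylinder with
initial condition `x 0 = x₀`. Derivatives on the circle are taken along a real-valued lift `q` of
the angle; every differentiable curve in the circle has one. -/
def IsSolution (P : AcrobotParams) (I : ℝ) (x₀ : State) (x : ℝ → State) : Prop :=
  x 0 = x₀ ∧
    ∃ q p : ℝ → ℝ,
      (∀ t, x t = ((q t : Real.Angle), p t)) ∧
      (∀ t, HasDerivAt q (P.qDot I (q t) (p t)) t) ∧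
      (∀ t, HasDerivAt p (P.pDot I (q t) (p t)) t)

/-- Mechanical energy of the nominal pendulum (legs fully extended). -/
noncomputable def energy (P : AcrobotParams) (x : State) : ℝ :=
  x.2 ^ 2 / (10 * P.m * P.l ^ 2) + 3 * P.m * P.g * P.l * (1 - Real.Angle.cos x.1)

/-- The critical energy `E(π, 0)`, separating oscillations from rotations. -/
noncomputable def Rbar (P : AcrobotParams) : ℝ :=
  P.energy ((Real.pi : Real.Angle), 0)

/-- The level set `E_R`. -/
def energyLevel (P : AcrobotParams) (R : ℝ) : Set State :=
  {x | P.energy x = R}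

/-- The set `E_[R₁, R₂]`. -/
def energyBand (P : AcrobotParams) (R₁ R₂ : ℝ) : Set State :=
  {x | R₁ ≤ P.energy x ∧ P.energy x ≤ R₂}

/-- The Poincaré section for rotations: energy above `Rbar` and `q_u = 0` (mod `2π`). -/
def rotationSection (P : AcrobotParams) : Set State :=
  {x | P.Rbar < P.energy x ∧ x.1 = 0}

/-- Euclidean norm of `(q_u, p_u)`, with `q_u` represented in `(-π, π]`. -/
noncomputable def stateNorm (x : State) : ℝ :=
  Real.sqrt (x.1.toReal ^ 2 + x.2 ^ 2)

/-- The curve `x` is a rotation over `[0, T]`. -/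
def IsRotation (P : AcrobotParams) (x : ℝ → State) (T : ℝ) : Prop :=
  IsDiscrete (x '' Set.Icc 0 T ∩ P.rotationSection)

/-- The strictly increasing finite sequence `t` lists exactly the times in `[0, T]` at which `x`
meets the Poincaré section. -/
def IsCrossingSequence (P : AcrobotParams) (x : ℝ → State) (T : ℝ) {n : ℕ} (t : Fin n → ℝ) :
    Prop :=
  StrictMono t ∧ Set.range t = {s | s ∈ Set.Icc 0 T ∧ x s ∈ P.rotationSection}

/-- `x` is a rotation gaining energy over `[0, T]`. -/
def IsRotationGainingEnergy (P : AcrobotParams) (x : ℝ → State) (T : ℝ) : Prop :=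
  P.IsRotation x T ∧
    ∃ (n : ℕ) (t : Fin n → ℝ), P.IsCrossingSequence x T t ∧
      StrictMono (fun i => stateNorm (x (t i)))

/-- `x` is a rotation losing energy over `[0, T]`. -/
def IsRotationLosingEnergy (P : AcrobotParams) (x : ℝ → State) (T : ℝ) : Prop :=
  P.IsRotation x T ∧
    ∃ (n : ℕ) (t : Fin n → ℝ), P.IsCrossingSequence x T t ∧
      StrictAnti (fun i => stateNorm (x (t i)))

/-- The constant `C = m² g l³ qbar`. -/
noncomputable def C (P : AcrobotParams) : ℝ :=
  P.m ^ 2 * P.g * P.l ^ 3 * P.qbar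

/-- The function `b(r, θ)`. -/
noncomputable def b (P : AcrobotParams) (r θ : ℝ) : ℝ :=
  5 * P.C *
      (P.C / P.qbar * (18 * Real.sin θ ^ 2 + 30 * Real.cos θ * (1 - Real.cos θ))
        - Real.cos θ * r ^ 2)
    / (|r| * Real.sqrt (r ^ 2 - 30 * P.m ^ 2 * P.g * P.l ^ 3 * (1 - Real.cos θ)))

/-- The function `S(r) = ∫₀^{2π} b(r, θ) dθ`. -/
noncomputable def S (P : AcrobotParams) (r : ℝ) : ℝ :=
  ∫ θ in (0 : ℝ)..(2 * Real.pi), P.b r θ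

end AcrobotParams

/-! On the section `q ∈ 2πℤ` the norm of a state is a function of its energy: it is `√W`, where
`W = levelSq` is the squared momentum at the bottom of the energy level. For small `I` the quantity
`W` is slow, `W' = I * gainRate + o(I)`, and after dividing by the angular velocity
`ω = p / inertia` the mean of the rate over one turn of `q` is a positive multiple of `√W * S(√W)`.

The oscillating part of the rate is removed by a near-identity change of variable: with `Φ` the
`q`-primitive of the deviation of the rate per unit angle from its mean, made to vanish at `q = 0`,
the corrected level `V = W - I * Φ(W, q)` satisfies `I * V' ≥ κ * I ^ 2` for some `κ > 0`. Since
`V` stays within `O(I)` of `W`, this drives `W` out of the given band of levels through the end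
prescribed by the sign of `I`; since `V = W` on the section, `I * W` is strictly increasing along
the crossings. Rotations with `p < 0` are reduced to those with `p > 0` by the symmetry
`(q, p) ↦ (-q, -p)`. -/

open Set Filter Topology MeasureTheory

section IntegralCurve

variable {E : Type*} [NormedAddCommGroup E] [NormedSpace ℝ E] {F : E → E}

theorem hasMFDerivAt_smulRight_iff_hasDerivAt {γ : ℝ → E} {γ' : E} {t : ℝ} :
    HasMFDerivAt (modelWithCornersSelf ℝ ℝ) (modelWithCornersSelf ℝ E) γ t
      ((1 : ℝ →L[ℝ] ℝ).smulRight γ') ↔ HasDerivAt γ γ' t := by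
  rw [hasDerivAt_iff_hasFDerivAt]
  exact hasMFDerivAt_iff_hasFDerivAt.trans (by congr!)

theorem isMIntegralCurve_iff_forall_hasDerivAt {γ : ℝ → E} :
    IsMIntegralCurve (I := modelWithCornersSelf ℝ E) γ F ↔ ∀ t, HasDerivAt γ (F (γ t)) t :=
  forall_congr' fun _ ↦ hasMFDerivAt_smulRight_iff_hasDerivAt

theorem eq_of_forall_hasDerivAt_of_contDiff [CompleteSpace E] (hF : ContDiff ℝ 1 F)
    {γ γ' : ℝ → E} (hγ : ∀ t, HasDerivAt γ (F (γ t)) t) (hγ' : ∀ t, HasDerivAt γ' (F (γ' t)) t)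
    {t₀ : ℝ} (h : γ t₀ = γ' t₀) : γ = γ' :=
  isMIntegralCurve_Ioo_eq_of_contMDiff_boundaryless (I := modelWithCornersSelf ℝ E)
    (contMDiff_vectorSpace_iff_contDiff.2 hF) (isMIntegralCurve_iff_forall_hasDerivAt.2 hγ)
    (isMIntegralCurve_iff_forall_hasDerivAt.2 hγ') h

variable [ProperSpace E]

-- On the ball of radius `1 + ‖x‖` about `x` the field is at most `2 * A * (1 + ‖x‖)`, so the
-- time needed to leave the ball does not depend on `x`.
theorem exists_uniform_time_integralCurve (hF : LocallyLipschitz F) {A : ℝ}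
    (hgrowth : ∀ x, ‖F x‖ ≤ A * (1 + ‖x‖)) :
    ∃ ε > 0, ∀ x, ∃ γ : ℝ → E, γ 0 = x ∧ ∀ t ∈ Ioo (-ε) ε, HasDerivAt γ (F (γ t)) t := by
  have hA : 0 ≤ A := nonneg_of_mul_nonneg_left ((norm_nonneg _).trans (hgrowth 0)) (by positivity)
  refine ⟨1 / (2 * A + 1), by positivity, fun x ↦ ?_⟩
  set ε : ℝ := 1 / (2 * A + 1) with hε
  have hε_pos : 0 < ε := by positivity
  set a : ℝ := 1 + ‖x‖
  have ha_pos : 0 < a := by positivity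
  obtain ⟨K, hK⟩ := (hF.locallyLipschitzOn (s := Metric.closedBall x a)
    ).exists_lipschitzOnWith_of_compact (isCompact_closedBall x a)
  have hbound : ∀ y ∈ Metric.closedBall x a, ‖F y‖ ≤ 2 * A * a := fun y hy ↦ by
    have hy' : 1 + ‖y‖ ≤ 2 * a := by
      have := norm_le_norm_add_norm_sub' y x
      rw [mem_closedBall_iff_norm] at hy
      linarith
    calc ‖F y‖ ≤ A * (1 + ‖y‖) := hgrowth y
      _ ≤ A * (2 * a) := by gcongr
      _ = 2 * A * a := by ring
  have htime : 2 * A * a * ε ≤ a := by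
    rw [hε, mul_one_div, div_le_iff₀ (by positivity)]
    linarith
  have hpl : IsPicardLindelof (fun _ ↦ F) (tmin := -ε) (tmax := ε)
      ⟨0, by constructor <;> linarith⟩ x ⟨a, ha_pos.le⟩ 0 ⟨2 * A * a, by positivity⟩ K := by
    apply IsPicardLindelof.of_time_independent hbound hK
    simpa [hε_pos.le] using! htime
  obtain ⟨γ, hγ_zero, hγ⟩ := hpl.exists_eq_forall_mem_Icc_hasDerivWithinAt₀
  exact ⟨γ, hγ_zero, fun t ht ↦
    (hγ t (Ioo_subset_Icc_self ht)).hasDerivAt (Icc_mem_nhds ht.1 ht.2)⟩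

theorem exists_forall_hasDerivAt_of_linear_growth (hF : ContDiff ℝ 1 F) {A : ℝ}
    (hgrowth : ∀ x, ‖F x‖ ≤ A * (1 + ‖x‖)) (x₀ : E) :
    ∃ γ : ℝ → E, γ 0 = x₀ ∧ ∀ t, HasDerivAt γ (F (γ t)) t := by
  obtain ⟨ε, hε, hlocal⟩ := exists_uniform_time_integralCurve hF.locallyLipschitz hgrowth
  obtain ⟨γ, hγ_zero, hγ⟩ := exists_isMIntegralCurve_of_isMIntegralCurveOn
    (I := modelWithCornersSelf ℝ E) (contMDiff_vectorSpace_iff_contDiff.2 hF) hε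
    (fun x ↦ (hlocal x).imp fun γ ⟨hγ_zero, hγ⟩ ↦ ⟨hγ_zero, fun t ht ↦
      (hasMFDerivAt_smulRight_iff_hasDerivAt.2 (hγ t ht)).hasMFDerivWithinAt⟩) x₀
  exact ⟨γ, hγ_zero, isMIntegralCurve_iff_forall_hasDerivAt.1 hγ⟩

end IntegralCurve

section UniformExpansion

theorem exists_forall_norm_sub_le_of_isCompact {X E : Type*} [TopologicalSpace X]
    [SeminormedAddCommGroup E] {f : ℝ → X → E} (hf : Continuous (Function.uncurry f)) {K : Set X}
    (hK : IsCompact K) {η : ℝ} (hη : 0 < η) :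
    ∃ δ > 0, ∀ s, |s| < δ → ∀ x ∈ K, ‖f s x - f 0 x‖ ≤ η := by
  obtain ⟨v, hv, hfv⟩ := hK.mem_uniformity_of_prod (q := 0) (s := univ) hf.continuousOn
    (mem_univ _) (Metric.dist_mem_uniformity hη)
  rw [nhdsWithin_univ] at hv
  obtain ⟨δ, hδ, hball⟩ := Metric.mem_nhds_iff.1 hv
  refine ⟨δ, hδ, fun s hs x hx ↦ ?_⟩
  have hdist : dist (f s x) (f 0 x) < η := hfv s (hball (by simpa using hs)) x hx
  exact (dist_eq_norm (f s x) (f 0 x)).symm.trans_le hdist.le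

variable {X E : Type*} [NormedAddCommGroup X] [NormedSpace ℝ X] [NormedAddCommGroup E]
  [NormedSpace ℝ E] {f : ℝ → X → E}

theorem hasDerivAt_left_of_contDiff_uncurry (hf : ContDiff ℝ 1 (Function.uncurry f)) (s : ℝ)
    (x : X) : HasDerivAt (f · x) (deriv (f · x) s) s :=
  ((hf.comp₂ contDiff_id contDiff_const).differentiable one_ne_zero s).hasDerivAt

theorem continuous_uncurry_deriv_left (hf : ContDiff ℝ 1 (Function.uncurry f)) :
    Continuous (Function.uncurry fun s x ↦ deriv (f · x) s) := by
  have hderiv : (Function.uncurry fun s x ↦ deriv (f · x) s) =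
      fun z ↦ fderiv ℝ (Function.uncurry f) z (1, 0) := by
    ext ⟨s, x⟩
    exact ((hf.differentiable one_ne_zero (s, x)).hasFDerivAt.comp_hasDerivAt s
      ((hasDerivAt_id s).prodMk (hasDerivAt_const s x))).deriv
  rw [hderiv]
  exact (hf.continuous_fderiv one_ne_zero).clm_apply continuous_const

theorem exists_forall_norm_sub_sub_smul_le_of_isCompact
    (hf : ContDiff ℝ 1 (Function.uncurry f)) {K : Set X} (hK : IsCompact K) {η : ℝ} (hη : 0 < η) :
    ∃ δ > 0, ∀ s, |s| < δ → ∀ x ∈ K, ‖f s x - f 0 x - s • deriv (f · x) 0‖ ≤ η * |s| := by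
  obtain ⟨δ, hδ, hderiv⟩ :=
    exists_forall_norm_sub_le_of_isCompact (continuous_uncurry_deriv_left hf) hK hη
  refine ⟨δ, hδ, fun s hs x hx ↦ ?_⟩
  have hmvt := Convex.norm_image_sub_le_of_norm_hasDerivWithin_le (C := η) (x := 0) (y := s)
    (f := fun r ↦ f r x - r • deriv (f · x) 0) (s := Metric.ball 0 δ)
    (fun r _ ↦ ((hasDerivAt_left_of_contDiff_uncurry hf r x).sub
      ((hasDerivAt_id r).smul_const _)).hasDerivWithinAt)
    (fun r hr ↦ by simpa using hderiv r (by simpa using hr) x hx)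
    (convex_ball 0 δ) (Metric.mem_ball_self hδ) (by simpa using hs)
  simpa [sub_right_comm] using hmvt

end UniformExpansion

section OscillatingPrimitive

/-- The primitive, vanishing at `0`, of `f` minus its mean over `[0, T]`. It is the periodic
corrector of first order averaging when `f` has period `T`. -/
noncomputable def oscillatingPrimitive (f : ℝ → ℝ) (T q : ℝ) : ℝ :=
  ∫ θ in (0 : ℝ)..q, (f θ - ⨍ φ in (0 : ℝ)..T, f φ)

theorem hasDerivAt_oscillatingPrimitive {f : ℝ → ℝ} (hf : Continuous f) (T q : ℝ) :
    HasDerivAt (oscillatingPrimitive f T) (f q - ⨍ φ in (0 : ℝ)..T, f φ) q :=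
  (show Continuous fun θ ↦ f θ - ⨍ φ in (0 : ℝ)..T, f φ by fun_prop).integral_hasStrictDerivAt
    0 q |>.hasDerivAt

theorem oscillatingPrimitive_eq_sub {f : ℝ → ℝ} (hf : Continuous f) (T q : ℝ) :
    oscillatingPrimitive f T q = (∫ θ in (0 : ℝ)..q, f θ) - q / T * ∫ θ in (0 : ℝ)..T, f θ := by
  unfold oscillatingPrimitive
  rw [intervalIntegral.integral_sub (hf.intervalIntegrable _ _) intervalIntegrable_const,
    intervalIntegral.integral_const, interval_average_eq]
  simp only [sub_zero, smul_eq_mul]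
  ring

theorem oscillatingPrimitive_self {f : ℝ → ℝ} (hf : Continuous f) (T : ℝ) :
    oscillatingPrimitive f T T = 0 := by
  rcases eq_or_ne T 0 with rfl | hT
  · exact intervalIntegral.integral_same
  · rw [oscillatingPrimitive_eq_sub hf, div_self hT, one_mul, sub_self]

theorem oscillatingPrimitive_periodic {f : ℝ → ℝ} (hf : Continuous f) {T : ℝ}
    (hper : Function.Periodic f T) : Function.Periodic (oscillatingPrimitive f T) T := by
  intro q
  have hg : Continuous fun θ ↦ f θ - ⨍ φ in (0 : ℝ)..T, f φ := by fun_prop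
  have hgper : Function.Periodic (fun θ ↦ f θ - ⨍ φ in (0 : ℝ)..T, f φ) T :=
    fun θ ↦ by simp only [hper θ]
  have hperiod : ∫ θ in q..q + T, (f θ - ⨍ φ in (0 : ℝ)..T, f φ) = 0 := by
    rw [hgper.intervalIntegral_add_eq q 0, zero_add]
    exact oscillatingPrimitive_self hf T
  unfold oscillatingPrimitive
  rw [← intervalIntegral.integral_add_adjacent_intervals (hg.intervalIntegrable 0 q)
    (hg.intervalIntegrable q (q + T)), hperiod, add_zero]

theorem oscillatingPrimitive_int_mul {f : ℝ → ℝ} (hf : Continuous f) {T : ℝ}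
    (hper : Function.Periodic f T) (n : ℤ) : oscillatingPrimitive f T (n * T) = 0 := by
  rw [(oscillatingPrimitive_periodic hf hper).int_mul_eq]
  exact intervalIntegral.integral_same

theorem continuous_interval_average {X : Type*} [TopologicalSpace X] {f : X → ℝ → ℝ}
    (hf : Continuous (Function.uncurry f)) (a b : ℝ) :
    Continuous fun y ↦ ⨍ θ in a..b, f y θ := by
  simp only [interval_average_eq]
  have hint : Continuous fun y ↦ ∫ θ in a..b, f y θ :=
    intervalIntegral.continuous_parametric_intervalIntegral_of_continuous' hf a b
  exact hint.const_smul (b - a)⁻¹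

theorem continuous_uncurry_oscillatingPrimitive {X : Type*} [TopologicalSpace X]
    [FirstCountableTopology X] {f : X → ℝ → ℝ} (hf : Continuous (Function.uncurry f)) (T : ℝ) :
    Continuous (Function.uncurry fun y q ↦ oscillatingPrimitive (f y) T q) := by
  refine intervalIntegral.continuous_parametric_intervalIntegral_of_continuous
    (f := fun (z : X × ℝ) θ ↦ f z.1 θ - ⨍ φ in (0 : ℝ)..T, f z.1 φ) ?_ continuous_snd
  exact (hf.comp ((continuous_fst.comp continuous_fst).prodMk continuous_snd)).sub
    ((continuous_interval_average hf 0 T).comp (continuous_fst.comp continuous_fst))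

variable {f : ℝ → ℝ → ℝ}

theorem hasDerivAt_intervalIntegral_of_contDiff_uncurry (hf : ContDiff ℝ 1 (Function.uncurry f))
    (y a b : ℝ) :
    HasDerivAt (fun y ↦ ∫ θ in a..b, f y θ) (∫ θ in a..b, deriv (f · θ) y) y := by
  have hf' := continuous_uncurry_deriv_left hf
  obtain ⟨K, hK⟩ := (isCompact_closedBall y 1 |>.prod
    (isCompact_uIcc (a := a) (b := b))).exists_bound_of_continuousOn hf'.continuousOn
  have hc : ∀ y, Continuous (f y) := hf.continuous.uncurry_left
  exact (intervalIntegral.hasDerivAt_integral_of_dominated_loc_of_deriv_le (bound := fun _ ↦ K)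
    (Metric.closedBall_mem_nhds y one_pos)
    (Eventually.of_forall fun y ↦ (hc y).aestronglyMeasurable) ((hc y).intervalIntegrable a b)
    (hf'.uncurry_left y).aestronglyMeasurable
    (Eventually.of_forall fun θ hθ z hz ↦ hK (z, θ) ⟨hz, uIoc_subset_uIcc hθ⟩)
    (by simp) (Eventually.of_forall fun θ _ z _ ↦ hasDerivAt_left_of_contDiff_uncurry hf z θ)).2

theorem hasDerivAt_oscillatingPrimitive_left (hf : ContDiff ℝ 1 (Function.uncurry f))
    (T y q : ℝ) :
    HasDerivAt (fun y ↦ oscillatingPrimitive (f y) T q)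
      (oscillatingPrimitive (fun θ ↦ deriv (f · θ) y) T q) y := by
  have hc : ∀ y, Continuous (f y) := hf.continuous.uncurry_left
  have hc' : Continuous fun θ ↦ deriv (f · θ) y :=
    (continuous_uncurry_deriv_left hf).uncurry_left y
  simp only [oscillatingPrimitive_eq_sub (hc _), oscillatingPrimitive_eq_sub hc']
  exact (hasDerivAt_intervalIntegral_of_contDiff_uncurry hf y 0 q).sub
    ((hasDerivAt_intervalIntegral_of_contDiff_uncurry hf y 0 T).const_mul _)

theorem hasDerivAt_oscillatingPrimitive_comp (hf : ContDiff ℝ 1 (Function.uncurry f)) (T : ℝ)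
    {y q : ℝ → ℝ} {y' q' t : ℝ} (hy : HasDerivAt y y' t) (hq : HasDerivAt q q' t) :
    HasDerivAt (fun s ↦ oscillatingPrimitive (f (y s)) T (q s))
      (oscillatingPrimitive (fun θ ↦ deriv (f · θ) (y t)) T (q t) * y'
        + (f (y t) (q t) - ⨍ φ in (0 : ℝ)..T, f (y t) φ) * q') t := by
  have hf' := continuous_uncurry_deriv_left hf
  have hstrict := hasStrictFDerivAt_uncurry_coprod (𝕜 := ℝ) (u := (y t, q t))
    (f := fun y q ↦ oscillatingPrimitive (f y) T q)
    (f₁ := fun y q ↦ ContinuousLinearMap.toSpanSingleton ℝ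
      (oscillatingPrimitive (fun θ ↦ deriv (f · θ) y) T q))
    (f₂ := fun y q ↦ ContinuousLinearMap.toSpanSingleton ℝ (f y q - ⨍ φ in (0 : ℝ)..T, f y φ))
    (Eventually.of_forall fun z ↦ (hasDerivAt_oscillatingPrimitive_left hf T z.1 z.2).hasFDerivAt)
    (Eventually.of_forall fun z ↦ (hasDerivAt_oscillatingPrimitive
      (hf.continuous.uncurry_left z.1) T z.2).hasFDerivAt)
    ((ContinuousLinearMap.toSpanSingletonCLE (𝕜 := ℝ) (E := ℝ)).continuous.comp
      (continuous_uncurry_oscillatingPrimitive hf' T)).continuousAt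
    ((ContinuousLinearMap.toSpanSingletonCLE (𝕜 := ℝ) (E := ℝ)).continuous.comp
      (hf.continuous.sub ((continuous_interval_average hf.continuous 0 T).comp
        continuous_fst))).continuousAt
  refine (hstrict.hasFDerivAt.comp_hasDerivAt t (hy.prodMk hq)).congr_deriv ?_
  simp [Function.HasUncurry.uncurry, mul_comm]

theorem exists_forall_abs_le_of_periodic (hf : Continuous (Function.uncurry f)) {T : ℝ}
    (hT : 0 < T) (hper : ∀ y, Function.Periodic (f y) T) (a b : ℝ) :
    ∃ K > 0, ∀ y ∈ Icc a b, ∀ q, |f y q| ≤ K := by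
  obtain ⟨K, hK⟩ := (isCompact_Icc.prod isCompact_Icc).exists_bound_of_continuousOn
    (hf.continuousOn (s := Icc a b ×ˢ Icc 0 T))
  refine ⟨max K 1, by positivity, fun y hy q ↦ ?_⟩
  obtain ⟨s, hs, hqs⟩ := (hper y).exists_mem_Ico₀ hT q
  rw [hqs]
  exact (hK (y, s) ⟨hy, Ico_subset_Icc_self hs⟩).trans (le_max_left _ _)

end OscillatingPrimitive

section Averaging

theorem mul_sq_le_mul_sub_of_abs_le {I w' y' q' ω F M Φ m ω₀ L η K₁ K₂ : ℝ} (hm : 0 ≤ m)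
    (hM : m ≤ M) (hω₀ : 0 ≤ ω₀) (hω : ω₀ ≤ ω) (hw' : |w' - I * (ω * F)| ≤ η * |I|)
    (hq' : |q' - ω| ≤ η) (hy' : |y'| ≤ L * |I|) (hΦ : |Φ| ≤ K₁) (hF : |F - M| ≤ K₂) :
    (m * ω₀ - η * (1 + K₂) - K₁ * L * |I|) * I ^ 2 ≤ I * (w' - I * (Φ * y' + (F - M) * q')) := by
  have hdrift : m * ω₀ * I ^ 2 ≤ M * ω * I ^ 2 := by
    gcongr
    exact hm.trans hM
  have herr_w : |I * (w' - I * (ω * F))| ≤ η * I ^ 2 := by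
    rw [abs_mul, ← sq_abs I]
    linarith [mul_le_mul_of_nonneg_left hw' (abs_nonneg I)]
  have herr_y : |I ^ 2 * (Φ * y')| ≤ I ^ 2 * (K₁ * (L * |I|)) := by
    rw [abs_mul, abs_mul, abs_of_nonneg (sq_nonneg I)]
    gcongr
    exact (abs_nonneg Φ).trans hΦ
  have herr_q : |I ^ 2 * ((F - M) * (q' - ω))| ≤ I ^ 2 * (K₂ * η) := by
    rw [abs_mul, abs_mul, abs_of_nonneg (sq_nonneg I)]
    gcongr
    exact (abs_nonneg _).trans hF
  linarith [abs_le.1 herr_w, abs_le.1 herr_y, abs_le.1 herr_q]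

-- The corrector `I * oscillatingPrimitive (f (y s)) T (q s)` cancels the oscillating part of the
-- first order drift `I * ω * f`, leaving the mean of `f` and errors `o(I)`.
theorem exists_mul_sq_le_mul_deriv_sub_oscillatingPrimitive {f : ℝ → ℝ → ℝ}
    (hf : ContDiff ℝ 1 (Function.uncurry f)) {T : ℝ} (hT : 0 < T)
    (hper : ∀ y, Function.Periodic (f y) T) {a b m ω₀ : ℝ} (hm : 0 < m) (hω₀ : 0 < ω₀)
    (hmean : ∀ y ∈ Icc a b, m ≤ ⨍ θ in (0 : ℝ)..T, f y θ) :
    ∃ η > 0, ∀ L, ∃ δ > 0, ∀ I, |I| < δ → ∀ (w y q : ℝ → ℝ) (w' y' q' ω t : ℝ),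
      HasDerivAt w w' t → HasDerivAt y y' t → HasDerivAt q q' t → y t ∈ Icc a b → ω₀ ≤ ω →
      |w' - I * (ω * f (y t) (q t))| ≤ η * |I| → |q' - ω| ≤ η → |y'| ≤ L * |I| →
      ∃ v', HasDerivAt (fun s ↦ w s - I * oscillatingPrimitive (f (y s)) T (q s)) v' t ∧
        m * ω₀ / 2 * I ^ 2 ≤ I * v' := by
  have hf' := continuous_uncurry_deriv_left hf
  obtain ⟨K₁, hK₁, hΦ⟩ := exists_forall_abs_le_of_periodic
    (continuous_uncurry_oscillatingPrimitive hf' T) hT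
    (fun y ↦ oscillatingPrimitive_periodic (hf'.uncurry_left y)
      fun θ ↦ by simp only [hper _ θ]) a b
  obtain ⟨K₂, hK₂, hosc⟩ := exists_forall_abs_le_of_periodic
    (f := fun y q ↦ f y q - ⨍ θ in (0 : ℝ)..T, f y θ)
    (hf.continuous.sub ((continuous_interval_average hf.continuous 0 T).comp continuous_fst)) hT
    (fun y θ ↦ by simp only [hper y θ]) a b
  refine ⟨m * ω₀ / (4 * (1 + K₂)), by positivity, fun L ↦
    ⟨m * ω₀ / (4 * (K₁ * (|L| + 1))), by positivity, ?_⟩⟩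
  intro I hI w y q w' y' q' ω t hw hy hq hyt hω hw' hq' hy'
  refine ⟨_, hw.sub ((hasDerivAt_oscillatingPrimitive_comp hf T hy hq).const_mul I), ?_⟩
  refine le_trans ?_ (mul_sq_le_mul_sub_of_abs_le hm.le (hmean _ hyt) hω₀.le hω hw' hq' hy'
    (hΦ _ hyt _) (hosc _ hyt _))
  have hη : m * ω₀ / (4 * (1 + K₂)) * (1 + K₂) = m * ω₀ / 4 := by field_simp
  have hδ : K₁ * L * |I| ≤ m * ω₀ / 4 := by
    calc K₁ * L * |I| ≤ K₁ * (|L| + 1) * (m * ω₀ / (4 * (K₁ * (|L| + 1)))) := by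
          gcongr
          linarith [le_abs_self L]
      _ = m * ω₀ / 4 := by field_simp
  gcongr
  linarith

end Averaging

section HittingTime

theorem exists_first_exit {X : Type*} [TopologicalSpace X] {w : ℝ → X} (hw : Continuous w)
    {U : Set X} (hU : IsOpen U) (hw0 : w 0 ∈ closure U) {s : ℝ} (hs : 0 ≤ s) (hws : w s ∉ U) :
    ∃ r ∈ Icc 0 s, w r ∈ frontier U ∧ ∀ τ ∈ Icc 0 r, w τ ∈ closure U := by
  have hcomp : IsCompact (Icc 0 s ∩ w ⁻¹' Uᶜ) :=
    isCompact_Icc.inter_right (hU.isClosed_compl.preimage hw)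
  obtain ⟨r, ⟨hr, hwr⟩, hleast⟩ := hcomp.exists_isLeast ⟨s, ⟨hs, le_rfl⟩, hws⟩
  have hbefore : MapsTo w (Ico 0 r) U := fun τ hτ ↦
    by_contra fun h ↦ hτ.2.not_ge (hleast ⟨⟨hτ.1, hτ.2.le.trans hr.2⟩, h⟩)
  have hclosure : ∀ τ ∈ Icc 0 r, w τ ∈ closure U := by
    rcases hr.1.eq_or_lt with rfl | hr0
    · rintro τ ⟨h0τ, hτ0⟩
      rwa [le_antisymm hτ0 h0τ]
    · rw [← closure_Ico hr0.ne]
      exact hbefore.closure hw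
  exact ⟨r, hr, hU.frontier_eq ▸ ⟨hclosure r ⟨hr.1, le_rfl⟩, hwr⟩, hclosure⟩

theorem add_mul_le_of_le_hasDerivAt {v : ℝ → ℝ} {c T : ℝ}
    (hv : ∀ s ∈ Icc 0 T, ∃ v', HasDerivAt v v' s ∧ c ≤ v') {s t : ℝ} (hs : s ∈ Icc 0 T)
    (ht : t ∈ Icc 0 T) (hst : s ≤ t) : v s + c * (t - s) ≤ v t := by
  choose! v' hv' hc using hv
  have hmvt := (convex_Icc 0 T).mul_sub_le_image_sub_of_le_deriv
    (fun s hs ↦ (hv' s hs).continuousAt.continuousWithinAt)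
    (fun s hs ↦ (hv' s (interior_subset hs)).differentiableAt.differentiableWithinAt)
    (fun s hs ↦ (hv' s (interior_subset hs)).deriv ▸ hc s (interior_subset hs)) s hs t ht hst
  linarith

theorem exists_hitting_time_of_drift {w v : ℝ → ℝ} {a' a b η c : ℝ} (hw : Continuous w)
    (hw0 : w 0 ∈ Icc a b) (hη₀ : 0 ≤ η) (hη : 2 * η < a - a') (hc : 0 < c)
    (hdrift : ∀ τ ≥ 0, (∀ s ∈ Icc 0 τ, w s ∈ Icc a' b) →
      |v τ - w τ| ≤ η ∧ ∃ v', HasDerivAt v v' τ ∧ c ≤ v') :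
    ∃ T ≥ 0, w T = b ∧ ∀ s ∈ Icc 0 T, w s ∈ Icc a' b := by
  have ha'b : a' < b := by linarith [hw0.1, hw0.2]
  have hw0' : w 0 ∈ Icc a' b := ⟨by linarith [hw0.1], hw0.2⟩
  have hw_lower : ∀ τ ≥ 0, (∀ s ∈ Icc 0 τ, w s ∈ Icc a' b) → w 0 - 2 * η + c * τ ≤ w τ := by
    intro τ hτ hband
    have hgrowth := add_mul_le_of_le_hasDerivAt (fun s hs ↦
      (hdrift s hs.1 fun r hr ↦ hband r ⟨hr.1, hr.2.trans hs.2⟩).2) ⟨le_rfl, hτ⟩ ⟨hτ, le_rfl⟩ hτ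
    have hclose₀ := (hdrift 0 le_rfl fun s hs ↦ le_antisymm hs.2 hs.1 ▸ hw0').1
    linarith [abs_le.1 hclose₀, abs_le.1 (hdrift τ hτ hband).1]
  obtain ⟨s, hs, hws⟩ : ∃ s ≥ 0, w s ∉ Ioo a' b := by
    by_contra! hstay
    have hτ : 0 ≤ (b - w 0 + 2 * η) / c := div_nonneg (by linarith [hw0.2]) hc.le
    have := hw_lower _ hτ fun s hs ↦ Ioo_subset_Icc_self (hstay s hs.1)
    rw [mul_div_cancel₀ _ hc.ne'] at this
    linarith [(hstay _ hτ).2]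
  obtain ⟨T, hT, hwT, hband⟩ :=
    exists_first_exit hw isOpen_Ioo (closure_Ioo ha'b.ne ▸ hw0') hs hws
  rw [closure_Ioo ha'b.ne] at hband
  rw [frontier_Ioo ha'b] at hwT
  refine ⟨T, hT.1, hwT.resolve_left fun hwT' ↦ ?_, hband⟩
  have := hw_lower T hT.1 hband
  linarith [mul_nonneg hc.le hT.1, hw0.1]

theorem exists_hitting_time_of_signed_drift {w v : ℝ → ℝ} {a' a b b' η c I : ℝ}
    (hw : Continuous w) (hw0 : w 0 ∈ Icc a b) (hη₀ : 0 ≤ η) (hηa : 2 * η < a - a')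
    (hηb : 2 * η < b' - b) (hc : 0 < c) (hI : I ≠ 0)
    (hdrift : ∀ τ ≥ 0, (∀ s ∈ Icc 0 τ, w s ∈ Icc a' b') →
      |v τ - w τ| ≤ η ∧ ∃ v', HasDerivAt v v' τ ∧ c ≤ I * v') :
    ∃ T ≥ 0, (0 < I → w T = b) ∧ (I < 0 → w T = a) ∧ ∀ s ∈ Icc 0 T, w s ∈ Icc a' b' := by
  rcases hI.lt_or_gt with hI | hI
  · obtain ⟨T, hT, hwT, hband⟩ := exists_hitting_time_of_drift (w := -w) (v := -v) (a' := -b')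
      (a := -b) (b := -a) (c := c / -I) hw.neg ⟨neg_le_neg hw0.2, neg_le_neg hw0.1⟩ hη₀
      (by linarith) (div_pos hc (neg_pos.2 hI)) fun τ hτ hband ↦ by
        obtain ⟨hclose, v', hv', hcv'⟩ := hdrift τ hτ fun s hs ↦
          ⟨by linarith [neg_le_neg_iff.1 (hband s hs).2], neg_le_neg_iff.1 (hband s hs).1⟩
        refine ⟨by rwa [Pi.neg_apply, Pi.neg_apply, neg_sub_neg, abs_sub_comm], _, hv'.neg, ?_⟩
        rw [div_le_iff₀ (neg_pos.2 hI)]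
        linarith
    exact ⟨T, hT, fun h ↦ (h.not_gt hI).elim, fun _ ↦ neg_inj.1 hwT, fun s hs ↦
      ⟨by linarith [neg_le_neg_iff.1 (hband s hs).2], neg_le_neg_iff.1 (hband s hs).1⟩⟩
  · obtain ⟨T, hT, hwT, hband⟩ := exists_hitting_time_of_drift (v := v) (c := c / I) hw hw0 hη₀ hηa
      (div_pos hc hI) fun τ hτ hband ↦ by
        obtain ⟨hclose, v', hv', hcv'⟩ := hdrift τ hτ fun s hs ↦
          ⟨(hband s hs).1, by linarith [(hband s hs).2]⟩
        exact ⟨hclose, v', hv', (div_le_iff₀ hI).2 (by linarith)⟩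
    exact ⟨T, hT, fun _ ↦ hwT, fun h ↦ (h.not_gt hI).elim, fun s hs ↦
      ⟨(hband s hs).1, by linarith [(hband s hs).2]⟩⟩

end HittingTime

section RealFunctions

theorem exists_enlargement_forall_le_of_pos {f : ℝ → ℝ} (hf : Continuous f) {a b : ℝ}
    (hab : a ≤ b) (hpos : ∀ x ∈ Icc a b, 0 < f x) :
    ∃ a' < a, ∃ b' > b, ∃ c > 0, ∀ x ∈ Icc a' b', c ≤ f x := by
  obtain ⟨c, hc, hcf⟩ := isCompact_Icc.exists_forall_le' hf.continuousOn hpos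
  obtain ⟨δ, hδ, hthick⟩ := isCompact_Icc.exists_cthickening_subset_open
    (isOpen_lt (continuous_const (y := c / 2)) hf) fun x hx ↦ (half_lt_self hc).trans_le (hcf x hx)
  refine ⟨a - δ, by linarith, b + δ, by linarith, c / 2, half_pos hc, fun x hx ↦ ?_⟩
  refine (hthick (Metric.mem_cthickening_of_dist_le x (max a (min x b)) δ _
    ⟨le_max_left _ _, max_le hab (min_le_right _ _)⟩ ?_)).le
  rw [Real.dist_eq, abs_le]
  obtain ⟨hx₁, hx₂⟩ := hx
  constructor <;> grind

theorem pos_of_forall_ne_zero {p : ℝ → ℝ} (hp : Continuous p) {τ : ℝ} (hp0 : 0 < p 0)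
    (hne : ∀ s ∈ Icc 0 τ, p s ≠ 0) : ∀ s ∈ Icc 0 τ, 0 < p s := by
  intro s hs
  by_contra! hneg
  obtain ⟨r, hr, hpr⟩ := intermediate_value_Icc' hs.1 hp.continuousOn ⟨hneg, hp0.le⟩
  exact hne r ⟨hr.1, hr.2.trans hs.2⟩ hpr

theorem finite_Icc_inter_cos_eq_one (a b : ℝ) : (Icc a b ∩ {x | Real.cos x = 1}).Finite := by
  have hfin : (zmultiplesHom ℝ (2 * Real.pi) ⁻¹' Icc a b).Finite := by
    have := Int.tendsto_zmultiplesHom_cofinite Real.two_pi_pos.ne'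
      (isCompact_Icc (a := a) (b := b)).compl_mem_cocompact
    rwa [mem_map, preimage_compl, mem_cofinite, compl_compl] at this
  refine (hfin.image (zmultiplesHom ℝ (2 * Real.pi))).subset fun x ⟨hx, hcos⟩ ↦ ?_
  obtain ⟨n, hn⟩ := (Real.cos_eq_one_iff x).1 hcos
  have hnx : zmultiplesHom ℝ (2 * Real.pi) n = x := by simpa using hn
  exact ⟨n, mem_preimage.2 (hnx ▸ hx), hnx⟩

theorem finite_setOf_cos_eq_one_of_strictMonoOn {q : ℝ → ℝ} {T : ℝ}
    (hq : StrictMonoOn q (Icc 0 T)) : {s ∈ Icc 0 T | Real.cos (q s) = 1}.Finite :=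
  Finite.of_injOn (f := q) (t := Icc (q 0) (q T) ∩ {x | Real.cos x = 1})
    (fun _ hs ↦ ⟨⟨hq.monotoneOn ⟨le_rfl, hs.1.1.trans hs.1.2⟩ hs.1 hs.1.1,
      hq.monotoneOn hs.1 ⟨hs.1.1.trans hs.1.2, le_rfl⟩ hs.1.2⟩, hs.2⟩)
    (hq.injOn.mono fun _ hs ↦ hs.1) (finite_Icc_inter_cos_eq_one _ _)

end RealFunctions

namespace AcrobotParams

variable (P : AcrobotParams)

section LiftedDynamics

/-- A solution of the constrained dynamics on the universal cover `ℝ × ℝ` of the cylinder. -/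
structure IsLiftedSolution (I : ℝ) (q p : ℝ → ℝ) : Prop where
  hasDerivAt_angle : ∀ t, HasDerivAt q (P.qDot I (q t) (p t)) t
  hasDerivAt_momentum : ∀ t, HasDerivAt p (P.pDot I (q t) (p t)) t

/-- The vector field of the constrained dynamics on the universal cover `ℝ × ℝ`. -/
noncomputable def liftedField (I : ℝ) (z : ℝ × ℝ) : ℝ × ℝ :=
  (P.qDot I z.1 z.2, P.pDot I z.1 z.2)

variable {P} {I : ℝ} {q p : ℝ → ℝ}

theorem isLiftedSolution_iff_forall_hasDerivAt :
    P.IsLiftedSolution I q p ↔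
      ∀ t, HasDerivAt (fun t ↦ (q t, p t)) (P.liftedField I (q t, p t)) t :=
  ⟨fun h t ↦ (h.1 t).prodMk (h.2 t), fun h ↦
    ⟨fun t ↦ (h t).fst, fun t ↦ (h t).snd⟩⟩

theorem isSolution_iff_exists_isLiftedSolution {x₀ : State} {x : ℝ → State} :
    P.IsSolution I x₀ x ↔ x 0 = x₀ ∧
      ∃ q p : ℝ → ℝ, (∀ t, x t = ((q t : Real.Angle), p t)) ∧ P.IsLiftedSolution I q p := by
  refine and_congr_right fun _ ↦ exists₂_congr fun _ _ ↦ and_congr_right fun _ ↦ ?_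
  exact ⟨fun h ↦ ⟨h.1, h.2⟩, fun h ↦ ⟨h.1, h.2⟩⟩

variable (P)

theorem qDot_add_int_mul_two_pi (I q p : ℝ) (n : ℤ) :
    P.qDot I (q + n * (2 * Real.pi)) p = P.qDot I q p := by
  unfold qDot
  rw [Real.sin_add_int_mul_two_pi, add_right_comm, Real.sin_add_int_mul_two_pi]

theorem pDot_add_int_mul_two_pi (I q p : ℝ) (n : ℤ) :
    P.pDot I (q + n * (2 * Real.pi)) p = P.pDot I q p := by
  unfold pDot
  rw [Real.sin_add_int_mul_two_pi, add_right_comm, Real.sin_add_int_mul_two_pi]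

theorem legAngle_neg (I p : ℝ) : P.legAngle I (-p) = -P.legAngle I p := by
  simp [legAngle, Real.arctan_neg]

theorem qDot_neg_neg (I q p : ℝ) : P.qDot I (-q) (-p) = -P.qDot I q p := by
  unfold qDot
  rw [legAngle_neg, ← neg_add, Real.sin_neg, Real.sin_neg, Real.cos_neg]
  ring

theorem pDot_neg_neg (I q p : ℝ) : P.pDot I (-q) (-p) = -P.pDot I q p := by
  unfold pDot
  rw [legAngle_neg, ← neg_add, Real.sin_neg, Real.sin_neg]
  ring

variable {P}

theorem IsLiftedSolution.add_int_mul_two_pi (h : P.IsLiftedSolution I q p) (n : ℤ) :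
    P.IsLiftedSolution I (fun t ↦ q t + n * (2 * Real.pi)) p where
  hasDerivAt_angle t := by
    simpa only [qDot_add_int_mul_two_pi] using (h.hasDerivAt_angle t).add_const _
  hasDerivAt_momentum t := by
    simpa only [pDot_add_int_mul_two_pi] using h.hasDerivAt_momentum t

theorem IsLiftedSolution.neg (h : P.IsLiftedSolution I q p) : P.IsLiftedSolution I (-q) (-p) where
  hasDerivAt_angle t := by
    simpa only [Pi.neg_apply, qDot_neg_neg] using (h.hasDerivAt_angle t).neg
  hasDerivAt_momentum t := by
    simpa only [Pi.neg_apply, pDot_neg_neg] using (h.hasDerivAt_momentum t).neg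

variable (P)

theorem C_pos : 0 < P.C := by
  have := P.m_pos
  have := P.g_pos
  have := P.l_pos
  have := P.qbar_pos
  unfold C
  positivity

theorem one_le_three_add_two_mul_cos (a : ℝ) : 1 ≤ 3 + 2 * Real.cos a := by
  linarith [Real.neg_one_le_cos a]

theorem qDot_denom_pos (I p : ℝ) :
    0 < P.m * P.l ^ 2 * (1 + I ^ 2 * p ^ 2) * (3 + 2 * Real.cos (P.legAngle I p)) := by
  have := P.m_pos
  have := P.l_pos
  have := one_le_three_add_two_mul_cos (P.legAngle I p)
  positivity

theorem contDiff_uncurry_liftedField : ContDiff ℝ 1 (Function.uncurry P.liftedField) := by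
  have hleg : ContDiff ℝ 1 fun z : ℝ × ℝ × ℝ ↦ P.legAngle z.1 z.2.2 :=
    contDiff_const.mul (Real.contDiff_arctan.comp (by fun_prop))
  refine ContDiff.prodMk (ContDiff.fun_div ?_ ?_ fun z ↦ (P.qDot_denom_pos z.1 z.2.2).ne') ?_
  · fun_prop
  · fun_prop
  · unfold pDot
    fun_prop

theorem abs_two_mul_sin_add_sin_le (q a : ℝ) : |2 * Real.sin q + Real.sin (q + a)| ≤ 3 := by
  rw [abs_le]
  constructor <;>
    linarith [Real.neg_one_le_sin q, Real.sin_le_one q, Real.neg_one_le_sin (q + a),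
      Real.sin_le_one (q + a)]

theorem abs_qDot_le (I q p : ℝ) : |P.qDot I q p| ≤ (|p| + 6 * P.C * |I|) / (P.m * P.l ^ 2) := by
  have hm := P.m_pos
  have hl := P.l_pos
  have hC := P.C_pos
  have hcos := one_le_three_add_two_mul_cos (P.legAngle I p)
  have hsin := abs_two_mul_sin_add_sin_le q (P.legAngle I p)
  have hone_add_cos : |1 + Real.cos (P.legAngle I p)| ≤ 2 := by
    rw [abs_le]
    constructor <;>
      linarith [Real.neg_one_le_cos (P.legAngle I p), Real.cos_le_one (P.legAngle I p)]
  have hN : 1 ≤ 1 + I ^ 2 * p ^ 2 := le_add_of_nonneg_right (by positivity)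
  unfold qDot
  rw [abs_div, abs_of_pos (P.qDot_denom_pos I p), div_le_div_iff₀ (P.qDot_denom_pos I p)
    (by positivity)]
  calc _ ≤ ((1 + I ^ 2 * p ^ 2) * |p| + P.C * |I| * 3 * 2) * (P.m * P.l ^ 2) := by
        gcongr
        refine (abs_add_le _ _).trans ?_
        rw [abs_mul, abs_mul, abs_mul, abs_mul, ← C, abs_of_pos hC,
          abs_of_pos (one_pos.trans_le hN)]
        gcongr
    _ ≤ ((1 + I ^ 2 * p ^ 2) * |p| + (1 + I ^ 2 * p ^ 2) * (P.C * |I| * 3 * 2))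
          * (P.m * P.l ^ 2) := by
        gcongr (_ + ?_) * _
        exact le_mul_of_one_le_left (by positivity) hN
    _ = (|p| + 6 * P.C * |I|) * (P.m * P.l ^ 2 * (1 + I ^ 2 * p ^ 2)) := by ring
    _ ≤ (|p| + 6 * P.C * |I|) *
          (P.m * P.l ^ 2 * (1 + I ^ 2 * p ^ 2) * (3 + 2 * Real.cos (P.legAngle I p))) := by
        gcongr _ * ?_
        exact le_mul_of_one_le_right (by positivity) hcos

theorem abs_pDot_le (I q p : ℝ) : |P.pDot I q p| ≤ P.m * P.g * P.l * 3 := by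
  have := P.m_pos
  have := P.g_pos
  have := P.l_pos
  unfold pDot
  rw [abs_neg, abs_mul, abs_of_pos (by positivity : 0 < P.m * P.g * P.l)]
  gcongr
  exact abs_two_mul_sin_add_sin_le q (P.legAngle I p)

theorem norm_liftedField_le (I : ℝ) (z : ℝ × ℝ) : ‖P.liftedField I z‖ ≤
    ((1 + 6 * P.C * |I|) / (P.m * P.l ^ 2) + P.m * P.g * P.l * 3) * (1 + ‖z‖) := by
  have hm := P.m_pos
  have hg := P.g_pos
  have hl := P.l_pos
  have hC := P.C_pos
  refine max_le ((P.abs_qDot_le I z.1 z.2).trans ?_) ((P.abs_pDot_le I z.1 z.2).trans ?_)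
  · have hp : |z.2| ≤ ‖z‖ := norm_snd_le z
    have hnum : |z.2| + 6 * P.C * |I| ≤ (1 + 6 * P.C * |I|) * (1 + ‖z‖) := by
      nlinarith [show 0 ≤ 6 * P.C * |I| * ‖z‖ by positivity]
    calc _ ≤ (1 + 6 * P.C * |I|) * (1 + ‖z‖) / (P.m * P.l ^ 2) := by gcongr
      _ = (1 + 6 * P.C * |I|) / (P.m * P.l ^ 2) * (1 + ‖z‖) := by ring
      _ ≤ _ := by
        gcongr
        exact le_add_of_nonneg_right (by positivity)
  · calc P.m * P.g * P.l * 3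
        ≤ (1 + 6 * P.C * |I|) / (P.m * P.l ^ 2) + P.m * P.g * P.l * 3 :=
          le_add_of_nonneg_left (by positivity)
      _ ≤ _ := le_mul_of_one_le_right (by positivity) (le_add_of_nonneg_right (norm_nonneg z))

theorem exists_isSolution (I : ℝ) (x₀ : State) : ∃ x, P.IsSolution I x₀ x := by
  obtain ⟨θ, p₀⟩ := x₀
  induction θ using Real.Angle.induction_on with
  | _ q₀ =>
  obtain ⟨γ, hγ_zero, hγ⟩ := exists_forall_hasDerivAt_of_linear_growth
    (P.contDiff_uncurry_liftedField.comp₂ contDiff_const contDiff_id) (P.norm_liftedField_le I)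
    (q₀, p₀)
  exact ⟨fun t ↦ (((γ t).1 : Real.Angle), (γ t).2), isSolution_iff_exists_isLiftedSolution.2
    ⟨by simp [hγ_zero], fun t ↦ (γ t).1, fun t ↦ (γ t).2, fun _ ↦ rfl,
      isLiftedSolution_iff_forall_hasDerivAt.2 hγ⟩⟩

variable {P}

theorem IsSolution.unique {x₀ : State} {x y : ℝ → State} (hx : P.IsSolution I x₀ x)
    (hy : P.IsSolution I x₀ y) : x = y := by
  obtain ⟨hx₀, q, p, hxqp, hqp⟩ := isSolution_iff_exists_isLiftedSolution.1 hx
  obtain ⟨hy₀, q', p', hyqp, hqp'⟩ := isSolution_iff_exists_isLiftedSolution.1 hy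
  have h₀ : ((q 0 : Real.Angle), p 0) = ((q' 0 : Real.Angle), p' 0) := by
    rw [← hxqp, ← hyqp, hx₀, hy₀]
  obtain ⟨hq₀, hp₀⟩ := Prod.ext_iff.1 h₀
  obtain ⟨n, hn⟩ := Real.Angle.angle_eq_iff_two_pi_dvd_sub.1 hq₀
  have heq : (fun t ↦ (q t, p t)) = fun t ↦ (q' t + n * (2 * Real.pi), p' t) :=
    eq_of_forall_hasDerivAt_of_contDiff
      (P.contDiff_uncurry_liftedField.comp₂ contDiff_const contDiff_id)
      (isLiftedSolution_iff_forall_hasDerivAt.1 hqp)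
      (isLiftedSolution_iff_forall_hasDerivAt.1 (hqp'.add_int_mul_two_pi n)) (t₀ := 0)
      (Prod.ext (by dsimp only; linarith) hp₀)
  funext t
  obtain ⟨hq, hp⟩ := Prod.ext_iff.1 (congrFun heq t)
  rw [hxqp, hyqp]
  refine Prod.ext (Real.Angle.angle_eq_iff_two_pi_dvd_sub.2 ⟨n, ?_⟩) hp
  dsimp only at hq
  linarith

theorem existsUnique_isSolution (P : AcrobotParams) (I : ℝ) (x₀ : State) :
    ∃! x, P.IsSolution I x₀ x := by
  obtain ⟨x, hx⟩ := P.exists_isSolution I x₀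
  exact ⟨x, hx, fun y hy ↦ hy.unique hx⟩

end LiftedDynamics

section EnergyRate

/-- The moment of inertia of the pendulum with extended legs: the nominal energy is
`p ^ 2 / (2 * inertia)` plus the potential. -/
noncomputable def inertia : ℝ := 5 * P.m * P.l ^ 2

/-- The constant `C / qbar`, which scales the potential in units of `p ^ 2`. -/
noncomputable def potentialScale : ℝ := P.m ^ 2 * P.g * P.l ^ 3

/-- The squared momentum `p ^ 2` at the bottom `q = 0` of the energy level through `(q, p)`: the
energy, rescaled by twice the inertia. -/
noncomputable def levelSq (q p : ℝ) : ℝ := p ^ 2 + 30 * P.potentialScale * (1 - Real.cos q)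

/-- The value of `levelSq` on the separatrix through `(π, 0)`. -/
noncomputable def criticalSq : ℝ := 60 * P.potentialScale

/-- The derivative of `levelSq` along the constrained dynamics. -/
noncomputable def levelSqDot (I q p : ℝ) : ℝ :=
  2 * p * P.pDot I q p + 30 * P.potentialScale * (Real.sin q * P.qDot I q p)

/-- The coefficient of `I` in the expansion of `levelSqDot` at `I = 0`. -/
noncomputable def gainRate (q p : ℝ) : ℝ :=
  10 * P.C * (18 * P.potentialScale * Real.sin q ^ 2 - p ^ 2 * Real.cos q) / P.inertia

theorem inertia_pos : 0 < P.inertia := by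
  have := P.m_pos
  have := P.l_pos
  unfold inertia
  positivity

theorem potentialScale_pos : 0 < P.potentialScale := by
  have := P.m_pos
  have := P.g_pos
  have := P.l_pos
  unfold potentialScale
  positivity

theorem levelSq_neg_neg (q p : ℝ) : P.levelSq (-q) (-p) = P.levelSq q p := by
  simp [levelSq]

theorem sq_le_levelSq (q p : ℝ) : p ^ 2 ≤ P.levelSq q p :=
  le_add_of_nonneg_right (mul_nonneg (by linarith [P.potentialScale_pos])
    (sub_nonneg.2 (Real.cos_le_one q)))

theorem levelSq_sub_criticalSq_le_sq (q p : ℝ) : P.levelSq q p - P.criticalSq ≤ p ^ 2 := by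
  unfold levelSq criticalSq
  nlinarith [P.potentialScale_pos, Real.neg_one_le_cos q]

variable {P} in
theorem IsLiftedSolution.hasDerivAt_levelSq {I : ℝ} {q p : ℝ → ℝ} (h : P.IsLiftedSolution I q p)
    (t : ℝ) : HasDerivAt (fun t ↦ P.levelSq (q t) (p t)) (P.levelSqDot I (q t) (p t)) t := by
  refine (((h.hasDerivAt_momentum t).fun_pow 2).fun_add
    (((h.hasDerivAt_angle t).cos.const_sub 1).const_mul _)).congr_deriv ?_
  unfold levelSqDot
  push_cast
  ring

theorem contDiff_uncurry_qDot :
    ContDiff ℝ 1 (Function.uncurry fun I (z : ℝ × ℝ) ↦ P.qDot I z.1 z.2) :=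
  P.contDiff_uncurry_liftedField.fst

theorem contDiff_uncurry_levelSqDot :
    ContDiff ℝ 1 (Function.uncurry fun I (z : ℝ × ℝ) ↦ P.levelSqDot I z.1 z.2) := by
  have hq := P.contDiff_uncurry_liftedField.fst
  have hp := P.contDiff_uncurry_liftedField.snd
  exact ((contDiff_const.mul (by fun_prop)).mul hp).add (contDiff_const.mul (.mul (by fun_prop) hq))

theorem legAngle_zero_left (p : ℝ) : P.legAngle 0 p = 0 := by
  simp [legAngle]

theorem qDot_zero_left (q p : ℝ) : P.qDot 0 q p = p / P.inertia := by
  simp only [qDot, inertia, legAngle_zero_left, Real.cos_zero]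
  ring

theorem levelSqDot_zero_left (q p : ℝ) : P.levelSqDot 0 q p = 0 := by
  have := P.m_pos.ne'
  have := P.l_pos.ne'
  simp only [levelSqDot, qDot_zero_left, pDot, legAngle_zero_left, potentialScale, inertia,
    add_zero]
  field

theorem hasDerivAt_legAngle_zero_left (p : ℝ) :
    HasDerivAt (P.legAngle · p) (P.qbar * p) 0 := by
  simpa using! ((hasDerivAt_mul_const p).arctan (x := (0 : ℝ))).const_mul P.qbar

theorem hasDerivAt_pDot_zero_left (q p : ℝ) :
    HasDerivAt (P.pDot · q p) (-(P.m * P.g * P.l * (Real.cos q * (P.qbar * p)))) 0 := by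
  have hsin := ((P.hasDerivAt_legAngle_zero_left p).const_add q).sin.const_add (2 * Real.sin q)
  simpa [legAngle_zero_left] using! (hsin.const_mul (P.m * P.g * P.l)).neg

theorem hasDerivAt_qDot_zero_left (q p : ℝ) :
    HasDerivAt (P.qDot · q p) (6 * P.C * Real.sin q / P.inertia) 0 := by
  have hleg := P.hasDerivAt_legAngle_zero_left p
  have hN : HasDerivAt (fun I : ℝ ↦ 1 + I ^ 2 * p ^ 2) 0 0 := by
    simpa using (((hasDerivAt_id (0 : ℝ)).fun_pow 2).mul_const (p ^ 2)).const_add 1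
  have hnum := (hN.mul_const p).fun_add (((hasDerivAt_id (0 : ℝ)).const_mul
    (P.m ^ 2 * P.g * P.l ^ 3 * P.qbar)).fun_mul ((hleg.const_add q).sin.const_add
      (2 * Real.sin q)) |>.fun_mul (hleg.cos.const_add 1))
  have hden := (hN.const_mul (P.m * P.l ^ 2)).fun_mul ((hleg.cos.const_mul 2).const_add 3)
  refine (hnum.fun_div hden (P.qDot_denom_pos 0 p).ne').congr_deriv ?_
  have := P.m_pos.ne'
  have := P.l_pos.ne'
  simp only [zero_mul, mul_one, legAngle_zero_left, add_zero, id_eq, mul_zero, Real.cos_zero,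
    Real.sin_zero, neg_zero, zero_add, ne_eq, OfNat.ofNat_ne_zero, not_false_eq_true, zero_pow,
    one_mul, sub_zero, C, inertia]
  field

theorem hasDerivAt_levelSqDot_zero_left (q p : ℝ) :
    HasDerivAt (P.levelSqDot · q p) (P.gainRate q p) 0 := by
  have := P.m_pos.ne'
  have := P.l_pos.ne'
  refine (((P.hasDerivAt_pDot_zero_left q p).const_mul (2 * p)).fun_add
    (((P.hasDerivAt_qDot_zero_left q p).const_mul (Real.sin q)).const_mul _)).congr_deriv ?_
  unfold gainRate inertia potentialScale C
  field

theorem exists_field_expansion (M : ℝ) {η : ℝ} (hη : 0 < η) :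
    ∃ δ > 0, ∀ I, |I| < δ → ∀ q p, |p| ≤ M →
      |P.qDot I q p - p / P.inertia| ≤ η ∧ |P.levelSqDot I q p - I * P.gainRate q p| ≤ η * |I| := by
  have hK := (isCompact_Icc (a := 0) (b := 2 * Real.pi)).prod (isCompact_Icc (a := -M) (b := M))
  obtain ⟨δ₁, hδ₁, hq⟩ :=
    exists_forall_norm_sub_le_of_isCompact P.contDiff_uncurry_qDot.continuous hK hη
  obtain ⟨δ₂, hδ₂, hlevel⟩ :=
    exists_forall_norm_sub_sub_smul_le_of_isCompact P.contDiff_uncurry_levelSqDot hK hη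
  refine ⟨min δ₁ δ₂, lt_min hδ₁ hδ₂, fun I hI q p hp ↦ ?_⟩
  have hreduced : ∀ q ∈ Icc 0 (2 * Real.pi), |P.qDot I q p - p / P.inertia| ≤ η ∧
      |P.levelSqDot I q p - I * P.gainRate q p| ≤ η * |I| := by
    intro q hq'
    have h₁ := hq I (hI.trans_le (min_le_left _ _)) (q, p) ⟨hq', abs_le.1 hp⟩
    have h₂ := hlevel I (hI.trans_le (min_le_right _ _)) (q, p) ⟨hq', abs_le.1 hp⟩
    simp only [qDot_zero_left, Real.norm_eq_abs] at h₁
    simp only [levelSqDot_zero_left, (P.hasDerivAt_levelSqDot_zero_left q p).deriv, sub_zero,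
      smul_eq_mul, Real.norm_eq_abs] at h₂
    exact ⟨h₁, h₂⟩
  obtain ⟨n, hn, -⟩ := existsUnique_add_zsmul_mem_Ico Real.two_pi_pos q 0
  rw [zero_add] at hn
  simpa only [zsmul_eq_mul, levelSqDot, gainRate, qDot_add_int_mul_two_pi,
    pDot_add_int_mul_two_pi, Real.sin_add_int_mul_two_pi, Real.cos_add_int_mul_two_pi]
    using hreduced _ (Ico_subset_Icc_self hn)

end EnergyRate

section AngularGain

/-- The squared momentum at the angle `θ` on a rotation level of `levelSq`. The excess of the level
over `criticalSq` is written `exp y`, so that this and `angularGain` are smooth on `ℝ × ℝ`. -/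
noncomputable def momentumSq (y θ : ℝ) : ℝ :=
  30 * P.potentialScale * (1 + Real.cos θ) + Real.exp y

/-- The coefficient of `I` in the expansion at `I = 0` of the derivative of `levelSq` with respect
to the angle, on the part `p > 0` of the level `levelSq = criticalSq + exp y`. -/
noncomputable def angularGain (y θ : ℝ) : ℝ :=
  10 * P.C * (18 * P.potentialScale * Real.sin θ ^ 2 - P.momentumSq y θ * Real.cos θ)
    / √(P.momentumSq y θ)

theorem momentumSq_pos (y θ : ℝ) : 0 < P.momentumSq y θ :=
  add_pos_of_nonneg_of_pos (mul_nonneg (by linarith [P.potentialScale_pos])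
    (by linarith [Real.neg_one_le_cos θ])) (Real.exp_pos y)

theorem contDiff_uncurry_angularGain : ContDiff ℝ 1 (Function.uncurry P.angularGain) := by
  have hρ : ContDiff ℝ 1 fun z : ℝ × ℝ ↦ P.momentumSq z.1 z.2 := by
    unfold momentumSq
    fun_prop
  refine ContDiff.fun_div (by fun_prop) (hρ.sqrt fun z ↦ (P.momentumSq_pos z.1 z.2).ne')
    fun z ↦ (Real.sqrt_pos.2 (P.momentumSq_pos z.1 z.2)).ne'

theorem angularGain_periodic (y : ℝ) : Function.Periodic (P.angularGain y) (2 * Real.pi) :=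
  fun θ ↦ by simp only [angularGain, momentumSq, Real.sin_add_two_pi, Real.cos_add_two_pi]

theorem momentumSq_log {q p : ℝ} (h : P.criticalSq < P.levelSq q p) :
    P.momentumSq (Real.log (P.levelSq q p - P.criticalSq)) q = p ^ 2 := by
  rw [momentumSq, Real.exp_log (sub_pos.2 h)]
  unfold levelSq criticalSq
  ring

theorem gainRate_eq_mul_angularGain {q p : ℝ} (hp : 0 < p) (h : P.criticalSq < P.levelSq q p) :
    P.gainRate q p =
      p / P.inertia * P.angularGain (Real.log (P.levelSq q p - P.criticalSq)) q := by
  have := P.inertia_pos.ne'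
  rw [gainRate, angularGain, P.momentumSq_log h, Real.sqrt_sq hp.le]
  field

theorem angularGain_eq_mul_b (y θ : ℝ) :
    P.angularGain y θ = 2 * √(P.criticalSq + Real.exp y) * P.b √(P.criticalSq + Real.exp y) θ := by
  have hβ := P.potentialScale_pos
  have hq := P.qbar_pos.ne'
  have hw : 0 < P.criticalSq + Real.exp y := by
    unfold criticalSq
    positivity
  have hρ : P.criticalSq + Real.exp y - 30 * P.m ^ 2 * P.g * P.l ^ 3 * (1 - Real.cos θ) =
      P.momentumSq y θ := by
    unfold criticalSq momentumSq potentialScale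
    ring
  have hρ_ne := (Real.sqrt_pos.2 (P.momentumSq_pos y θ)).ne'
  have hw_ne := (Real.sqrt_pos.2 hw).ne'
  have hC : P.C / P.qbar = P.potentialScale := by
    unfold C potentialScale
    field
  rw [b, abs_of_pos (Real.sqrt_pos.2 hw), Real.sq_sqrt hw.le, hρ, hC, angularGain]
  field_simp
  unfold criticalSq momentumSq
  ring

theorem interval_average_angularGain (y : ℝ) :
    ⨍ θ in (0 : ℝ)..2 * Real.pi, P.angularGain y θ =
      √(P.criticalSq + Real.exp y) * P.S √(P.criticalSq + Real.exp y) / Real.pi := by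
  simp only [angularGain_eq_mul_b, interval_average_eq_div, intervalIntegral.integral_const_mul]
  unfold S
  field

/-- `levelSq` minus the oscillating part, to first order in `I`, of its variation over one turn. -/
noncomputable def correctedLevelSq (I q p : ℝ) : ℝ :=
  P.levelSq q p - I * oscillatingPrimitive
    (P.angularGain (Real.log (P.levelSq q p - P.criticalSq))) (2 * Real.pi) q

theorem correctedLevelSq_of_cos_eq_one (I p : ℝ) {q : ℝ} (hq : Real.cos q = 1) :
    P.correctedLevelSq I q p = P.levelSq q p := by
  obtain ⟨n, rfl⟩ := (Real.cos_eq_one_iff q).1 hq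
  rw [correctedLevelSq, oscillatingPrimitive_int_mul
    (P.contDiff_uncurry_angularGain.continuous.uncurry_left _)
    (P.angularGain_periodic _), mul_zero, sub_zero]

end AngularGain

section Drift

theorem log_levelSq_sub_mem_Icc {y₁ y₂ q p : ℝ} (h : P.levelSq q p ∈
    Icc (P.criticalSq + Real.exp y₁) (P.criticalSq + Real.exp y₂)) :
    P.criticalSq < P.levelSq q p ∧ Real.log (P.levelSq q p - P.criticalSq) ∈ Icc y₁ y₂ := by
  obtain ⟨h₁, h₂⟩ := h
  have hpos : 0 < P.levelSq q p - P.criticalSq := by linarith [Real.exp_pos y₁]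
  exact ⟨sub_pos.1 hpos, (Real.le_log_iff_exp_le hpos).2 (by linarith),
    (Real.log_le_iff_le_exp hpos).2 (by linarith)⟩

theorem exists_level_expansion (y₁ y₂ : ℝ) {η : ℝ} (hη : 0 < η) :
    ∃ L, ∃ δ > 0, ∀ I, |I| < δ → ∀ q p, 0 < p →
      P.levelSq q p ∈ Icc (P.criticalSq + Real.exp y₁) (P.criticalSq + Real.exp y₂) →
      |P.qDot I q p - p / P.inertia| ≤ η ∧
      |P.levelSqDot I q p - I * (p / P.inertia *
        P.angularGain (Real.log (P.levelSq q p - P.criticalSq)) q)| ≤ η * |I| ∧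
      |P.levelSqDot I q p / (P.levelSq q p - P.criticalSq)| ≤ L * |I| := by
  set M := √(P.criticalSq + Real.exp y₂)
  have hgain : Continuous (Function.uncurry fun p q ↦ P.gainRate q p) := by
    unfold gainRate
    fun_prop
  obtain ⟨K, hK, hgain_le⟩ := exists_forall_abs_le_of_periodic hgain Real.two_pi_pos
    (fun p q ↦ by simp only [gainRate, Real.sin_add_two_pi, Real.cos_add_two_pi]) (-M) M
  obtain ⟨δ, hδ, hfield⟩ := P.exists_field_expansion M hη
  refine ⟨(η + K) / Real.exp y₁, δ, hδ, fun I hI q p hp hlevel ↦ ?_⟩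
  have hcrit := (P.log_levelSq_sub_mem_Icc hlevel).1
  have hpM : |p| ≤ M := Real.abs_le_sqrt ((P.sq_le_levelSq q p).trans hlevel.2)
  obtain ⟨hq, hdot⟩ := hfield I hI q p hpM
  refine ⟨hq, P.gainRate_eq_mul_angularGain hp hcrit ▸ hdot, ?_⟩
  have hdot_le : |P.levelSqDot I q p| ≤ (η + K) * |I| := by
    have hmain : |I * P.gainRate q p| ≤ K * |I| := by
      rw [abs_mul, mul_comm]
      gcongr
      exact hgain_le p (abs_le.1 hpM) q
    linarith [abs_sub_abs_le_abs_sub (P.levelSqDot I q p) (I * P.gainRate q p)]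
  have hexp : Real.exp y₁ ≤ P.levelSq q p - P.criticalSq := by linarith [hlevel.1]
  rw [abs_div, abs_of_pos (sub_pos.2 hcrit), div_mul_eq_mul_div]
  gcongr

theorem exists_drift_bounds {y₁ y₂ m : ℝ} (hm : 0 < m)
    (hmean : ∀ y ∈ Icc y₁ y₂, m ≤ ⨍ θ in (0 : ℝ)..2 * Real.pi, P.angularGain y θ) :
    ∃ δ > 0, ∃ κ > 0, ∃ K > 0, ∀ I, |I| < δ → ∀ q p : ℝ → ℝ, P.IsLiftedSolution I q p →
      ∀ t, 0 < p t →
      P.levelSq (q t) (p t) ∈ Icc (P.criticalSq + Real.exp y₁) (P.criticalSq + Real.exp y₂) →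
      |P.correctedLevelSq I (q t) (p t) - P.levelSq (q t) (p t)| ≤ K * |I| ∧
      0 < P.qDot I (q t) (p t) ∧
      ∃ v', HasDerivAt (fun s ↦ P.correctedLevelSq I (q s) (p s)) v' t ∧ κ * I ^ 2 ≤ I * v' := by
  have hf := P.contDiff_uncurry_angularGain
  set ω₀ := √(Real.exp y₁) / P.inertia
  have hω₀ : 0 < ω₀ := div_pos (Real.sqrt_pos.2 (Real.exp_pos y₁)) P.inertia_pos
  obtain ⟨K, hK, hΦ⟩ := exists_forall_abs_le_of_periodic
    (continuous_uncurry_oscillatingPrimitive hf.continuous _) Real.two_pi_pos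
    (fun y ↦ oscillatingPrimitive_periodic (hf.continuous.uncurry_left y)
      (P.angularGain_periodic y)) y₁ y₂
  obtain ⟨η, hη, haveraging⟩ := exists_mul_sq_le_mul_deriv_sub_oscillatingPrimitive hf
    Real.two_pi_pos P.angularGain_periodic hm hω₀ hmean
  obtain ⟨L, δ₁, hδ₁, hexpansion⟩ :=
    P.exists_level_expansion y₁ y₂ (lt_min hη (half_pos hω₀))
  obtain ⟨δ₂, hδ₂, hdrift⟩ := haveraging L
  refine ⟨min δ₁ δ₂, lt_min hδ₁ hδ₂, m * ω₀ / 2, by positivity, K, hK, ?_⟩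
  intro I hI q p hqp t hp hlevel
  obtain ⟨hcrit, hy⟩ := P.log_levelSq_sub_mem_Icc hlevel
  obtain ⟨hq', hdot, hlog⟩ := hexpansion I (hI.trans_le (min_le_left _ _)) (q t) (p t) hp hlevel
  have hω : ω₀ ≤ p t / P.inertia := by
    refine div_le_div_of_nonneg_right (Real.sqrt_le_iff.2 ⟨hp.le, ?_⟩) P.inertia_pos.le
    linarith [hlevel.1, P.levelSq_sub_criticalSq_le_sq (q t) (p t)]
  refine ⟨?_, ?_, ?_⟩
  · rw [correctedLevelSq, sub_sub_cancel_left, abs_neg, abs_mul, mul_comm]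
    gcongr
    exact hΦ _ hy _
  · linarith [abs_le.1 hq', min_le_right η (ω₀ / 2)]
  · have hlevel' := hqp.hasDerivAt_levelSq t
    exact hdrift I (hI.trans_le (min_le_right _ _)) _ _ _ _ _ _ _ _ hlevel'
      ((hlevel'.sub_const _).log (sub_pos.2 hcrit).ne') (hqp.hasDerivAt_angle t) hy hω
      (hdot.trans (by gcongr; exact min_le_left _ _)) (hq'.trans (min_le_left _ _)) hlog

end Drift

section MonotoneTransit

/-- Along the lifted curve `(q, p)`, the rescaled energy `levelSq` reaches `W₂` (if `0 < I`) or `W₁`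
(if `I < 0`) at time `T`, and until then it is strictly increasing (resp. decreasing) along the
passages through the bottom `q ∈ 2πℤ`, of which there are finitely many. Multiplication by `I`
treats both signs at once. -/
structure IsMonotoneTransit (I : ℝ) (q p : ℝ → ℝ) (W₁ W₂ T : ℝ) : Prop where
  nonneg : 0 ≤ T
  levelSq_eq_of_pos : 0 < I → P.levelSq (q T) (p T) = W₂
  levelSq_eq_of_neg : I < 0 → P.levelSq (q T) (p T) = W₁
  finite : {s ∈ Icc 0 T | Real.cos (q s) = 1}.Finite
  strictMonoOn : StrictMonoOn (fun s ↦ I * P.levelSq (q s) (p s))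
    {s ∈ Icc 0 T | Real.cos (q s) = 1}

variable {P}

theorem IsMonotoneTransit.of_neg {I : ℝ} {q p : ℝ → ℝ} {W₁ W₂ T : ℝ}
    (h : P.IsMonotoneTransit I (-q) (-p) W₁ W₂ T) : P.IsMonotoneTransit I q p W₁ W₂ T := by
  obtain ⟨hT, hpos, hneg, hfin, hmono⟩ := h
  simp only [Pi.neg_apply, levelSq_neg_neg, Real.cos_neg] at hpos hneg hfin hmono
  exact ⟨hT, hpos, hneg, hfin, hmono⟩

theorem momentum_ne_zero_of_criticalSq_lt {q p : ℝ} (h : P.criticalSq < P.levelSq q p) :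
    p ≠ 0 := by
  rintro rfl
  linarith [P.levelSq_sub_criticalSq_le_sq q 0]

theorem IsLiftedSolution.continuous_levelSq {I : ℝ} {q p : ℝ → ℝ} (h : P.IsLiftedSolution I q p) :
    Continuous fun t ↦ P.levelSq (q t) (p t) :=
  continuous_iff_continuousAt.2 fun t ↦ (h.hasDerivAt_levelSq t).continuousAt

theorem IsLiftedSolution.momentum_pos {I : ℝ} {q p : ℝ → ℝ} (h : P.IsLiftedSolution I q p)
    (hp0 : 0 < p 0) {T : ℝ} (hT : ∀ s ∈ Icc 0 T, P.criticalSq < P.levelSq (q s) (p s)) :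
    ∀ s ∈ Icc 0 T, 0 < p s :=
  pos_of_forall_ne_zero (continuous_iff_continuousAt.2 fun t ↦
    (h.hasDerivAt_momentum t).continuousAt) hp0 fun s hs ↦
      momentum_ne_zero_of_criticalSq_lt (hT s hs)

theorem IsLiftedSolution.finite_setOf_cos_eq_one {I : ℝ} {q p : ℝ → ℝ}
    (h : P.IsLiftedSolution I q p) {T : ℝ} (hT : ∀ s ∈ Icc 0 T, 0 < P.qDot I (q s) (p s)) :
    {s ∈ Icc 0 T | Real.cos (q s) = 1}.Finite :=
  finite_setOf_cos_eq_one_of_strictMonoOn <| strictMonoOn_of_hasDerivWithinAt_pos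
    (convex_Icc 0 T) (fun s _ ↦ (h.hasDerivAt_angle s).continuousAt.continuousWithinAt)
    (fun s _ ↦ (h.hasDerivAt_angle s).hasDerivWithinAt) fun s hs ↦ hT s (interior_subset hs)

theorem strictMonoOn_mul_levelSq {I T c : ℝ} {q p : ℝ → ℝ} (hc : 0 < c)
    (h : ∀ s ∈ Icc 0 T, ∃ v',
      HasDerivAt (fun s ↦ P.correctedLevelSq I (q s) (p s)) v' s ∧ c ≤ I * v') :
    StrictMonoOn (fun s ↦ I * P.levelSq (q s) (p s)) {s ∈ Icc 0 T | Real.cos (q s) = 1} := by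
  intro s hs t ht hst
  have hgrowth := add_mul_le_of_le_hasDerivAt (fun r hr ↦ by
    obtain ⟨v', hv', hcv'⟩ := h r hr
    exact ⟨_, hv'.const_mul I, hcv'⟩) hs.1 ht.1 hst.le
  simp only [correctedLevelSq_of_cos_eq_one, hs.2, ht.2] at hgrowth
  linarith [mul_pos hc (sub_pos.2 hst)]

variable (P)

theorem exists_isMonotoneTransit_of_pos {y₁ y₂ : ℝ} (hy : y₁ ≤ y₂)
    (hmean : ∀ y ∈ Icc y₁ y₂, 0 < ⨍ θ in (0 : ℝ)..2 * Real.pi, P.angularGain y θ) :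
    ∃ δ > 0, ∀ I ≠ 0, |I| < δ → ∀ q p : ℝ → ℝ, P.IsLiftedSolution I q p → 0 < p 0 →
      P.levelSq (q 0) (p 0) ∈ Icc (P.criticalSq + Real.exp y₁) (P.criticalSq + Real.exp y₂) →
      ∃ T, P.IsMonotoneTransit I q p
        (P.criticalSq + Real.exp y₁) (P.criticalSq + Real.exp y₂) T := by
  obtain ⟨y₁', hy₁, y₂', hy₂, m, hm, hmean'⟩ := exists_enlargement_forall_le_of_pos
    (continuous_interval_average P.contDiff_uncurry_angularGain.continuous _ _) hy hmean
  obtain ⟨δ, hδ, κ, hκ, K, hK, hdrift⟩ := P.exists_drift_bounds hm hmean'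
  set gap := min (Real.exp y₁ - Real.exp y₁') (Real.exp y₂' - Real.exp y₂)
  have hgap : 0 < gap :=
    lt_min (sub_pos.2 (Real.exp_lt_exp.2 hy₁)) (sub_pos.2 (Real.exp_lt_exp.2 hy₂))
  refine ⟨min δ (gap / (2 * K)), by positivity, fun I hI hIδ q p hqp hp0 hlevel₀ ↦ ?_⟩
  have hbounds := fun t ↦ hdrift I (hIδ.trans_le (min_le_left _ _)) q p hqp t
  have hη : 2 * (K * |I|) < gap := by
    have := (lt_div_iff₀ (by positivity)).1 (hIδ.trans_le (min_le_right _ _))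
    linarith
  have hmomentum {τ : ℝ} (hband : ∀ s ∈ Icc 0 τ, P.levelSq (q s) (p s) ∈
      Icc (P.criticalSq + Real.exp y₁') (P.criticalSq + Real.exp y₂')) : ∀ s ∈ Icc 0 τ, 0 < p s :=
    hqp.momentum_pos hp0 fun s hs ↦ (P.log_levelSq_sub_mem_Icc (hband s hs)).1
  obtain ⟨T, hT, hpos, hneg, hband⟩ := exists_hitting_time_of_signed_drift
    (v := fun s ↦ P.correctedLevelSq I (q s) (p s)) (a' := P.criticalSq + Real.exp y₁')
    (b' := P.criticalSq + Real.exp y₂') (η := K * |I|) hqp.continuous_levelSq hlevel₀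
    (by positivity) (by linarith [hη.trans_le (min_le_left _ _)])
    (by linarith [hη.trans_le (min_le_right _ _)]) (by positivity : 0 < κ * I ^ 2) hI
    fun τ hτ hband ↦ by
      have hτ' : τ ∈ Icc 0 τ := ⟨hτ, le_rfl⟩
      obtain ⟨hclose, -, hderiv⟩ := hbounds τ (hmomentum hband τ hτ') (hband τ hτ')
      exact ⟨hclose, hderiv⟩
  have hbounds' := fun s hs ↦ hbounds s (hmomentum hband s hs) (hband s hs)
  exact ⟨T, hT, hpos, hneg, hqp.finite_setOf_cos_eq_one fun s hs ↦ (hbounds' s hs).2.1,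
    strictMonoOn_mul_levelSq (by positivity : 0 < κ * I ^ 2) fun s hs ↦ (hbounds' s hs).2.2⟩

theorem exists_isMonotoneTransit {W₁ W₂ : ℝ} (hW₁ : P.criticalSq < W₁) (hW : W₁ ≤ W₂)
    (hS : ∀ W ∈ Icc W₁ W₂, 0 < P.S √W) :
    ∃ δ > 0, ∀ I ≠ 0, |I| < δ → ∀ q p : ℝ → ℝ, P.IsLiftedSolution I q p →
      P.levelSq (q 0) (p 0) ∈ Icc W₁ W₂ → ∃ T, P.IsMonotoneTransit I q p W₁ W₂ T := by
  have hexp {W : ℝ} (hW : W₁ ≤ W) : P.criticalSq + Real.exp (Real.log (W - P.criticalSq)) = W := by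
    rw [Real.exp_log (sub_pos.2 (hW₁.trans_le hW)), add_sub_cancel]
  have hcrit : 0 < P.criticalSq := mul_pos (by norm_num) P.potentialScale_pos
  obtain ⟨δ, hδ, htransit⟩ := P.exists_isMonotoneTransit_of_pos
    (Real.log_le_log (sub_pos.2 hW₁) (sub_le_sub_right hW _)) fun y hy ↦ by
      have hy₁ := add_le_add_right (Real.exp_le_exp.2 hy.1) P.criticalSq
      have hy₂ := add_le_add_right (Real.exp_le_exp.2 hy.2) P.criticalSq
      rw [hexp le_rfl] at hy₁
      rw [hexp hW] at hy₂
      rw [interval_average_angularGain]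
      exact div_pos (mul_pos (Real.sqrt_pos.2 (by positivity)) (hS _ ⟨hy₁, hy₂⟩)) Real.pi_pos
  rw [hexp le_rfl, hexp hW] at htransit
  refine ⟨δ, hδ, fun I hI hIδ q p hqp hlevel₀ ↦ ?_⟩
  rcases (momentum_ne_zero_of_criticalSq_lt (hW₁.trans_le hlevel₀.1)).lt_or_gt with hneg | hpos
  · obtain ⟨T, hT⟩ := htransit I hI hIδ (-q) (-p) hqp.neg (neg_pos.2 hneg)
      (by rwa [Pi.neg_apply, Pi.neg_apply, levelSq_neg_neg])
    exact ⟨T, hT.of_neg⟩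
  · exact htransit I hI hIδ q p hqp hpos hlevel₀

end MonotoneTransit

section Crossings

theorem levelSq_eq_mul_energy (q p : ℝ) :
    P.levelSq q p = 10 * P.m * P.l ^ 2 * P.energy ((q : Real.Angle), p) := by
  have := P.m_pos.ne'
  have := P.l_pos.ne'
  rw [levelSq, energy, potentialScale, Real.Angle.cos_coe]
  field

theorem criticalSq_eq_mul_Rbar : P.criticalSq = 10 * P.m * P.l ^ 2 * P.Rbar := by
  rw [Rbar, ← levelSq_eq_mul_energy, levelSq, criticalSq, Real.cos_pi]
  ring

variable {P}

theorem cos_eq_one_of_mem_rotationSection {q p : ℝ}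
    (h : ((q : Real.Angle), p) ∈ P.rotationSection) : Real.cos q = 1 := by
  rw [← Real.Angle.cos_coe, show (q : Real.Angle) = 0 from h.2, Real.Angle.cos_zero]

theorem levelSq_eq_stateNorm_sq {q p : ℝ} (h : ((q : Real.Angle), p) ∈ P.rotationSection) :
    P.levelSq q p = stateNorm ((q : Real.Angle), p) ^ 2 := by
  rw [stateNorm, Real.sq_sqrt (by positivity), levelSq, cos_eq_one_of_mem_rotationSection h,
    show (q : Real.Angle) = 0 from h.2, Real.Angle.toReal_zero]
  ring

/-- The times in `[0, T]` at which `x` meets the Poincaré section. -/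
def crossingTimes (P : AcrobotParams) (x : ℝ → State) (T : ℝ) : Set ℝ :=
  {s | s ∈ Icc 0 T ∧ x s ∈ P.rotationSection}

theorem isRotation_of_finite_crossingTimes {x : ℝ → State} {T : ℝ}
    (h : (P.crossingTimes x T).Finite) : P.IsRotation x T := by
  refine ((h.image x).subset ?_).isDiscrete
  rintro _ ⟨⟨s, hs, rfl⟩, hx⟩
  exact ⟨s, ⟨hs, hx⟩, rfl⟩

theorem exists_isCrossingSequence {x : ℝ → State} {T : ℝ} (h : (P.crossingTimes x T).Finite) :
    ∃ (n : ℕ) (t : Fin n → ℝ), P.IsCrossingSequence x T t :=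
  ⟨h.toFinset.card, h.toFinset.orderEmbOfFin rfl, (h.toFinset.orderEmbOfFin rfl).strictMono, by
    rw [Finset.range_orderEmbOfFin, Finite.coe_toFinset, crossingTimes]⟩

theorem IsCrossingSequence.mem_crossingTimes {x : ℝ → State} {T : ℝ} {n : ℕ} {t : Fin n → ℝ}
    (h : P.IsCrossingSequence x T t) (i : Fin n) : t i ∈ P.crossingTimes x T :=
  h.2.subset (mem_range_self i)

theorem isRotationGainingEnergy_of_strictMonoOn {x : ℝ → State} {T : ℝ}
    (hfin : (P.crossingTimes x T).Finite)
    (hmono : StrictMonoOn (fun s ↦ stateNorm (x s)) (P.crossingTimes x T)) :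
    P.IsRotationGainingEnergy x T := by
  obtain ⟨n, t, ht⟩ := exists_isCrossingSequence hfin
  exact ⟨isRotation_of_finite_crossingTimes hfin, n, t, ht, fun i j hij ↦
    hmono (ht.mem_crossingTimes i) (ht.mem_crossingTimes j) (ht.1 hij)⟩

theorem isRotationLosingEnergy_of_strictAntiOn {x : ℝ → State} {T : ℝ}
    (hfin : (P.crossingTimes x T).Finite)
    (hanti : StrictAntiOn (fun s ↦ stateNorm (x s)) (P.crossingTimes x T)) :
    P.IsRotationLosingEnergy x T := by
  obtain ⟨n, t, ht⟩ := exists_isCrossingSequence hfin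
  exact ⟨isRotation_of_finite_crossingTimes hfin, n, t, ht, fun i j hij ↦
    hanti (ht.mem_crossingTimes i) (ht.mem_crossingTimes j) (ht.1 hij)⟩

theorem IsMonotoneTransit.finite_crossingTimes {I W₁ W₂ T : ℝ} {q p : ℝ → ℝ} {x : ℝ → State}
    (h : P.IsMonotoneTransit I q p W₁ W₂ T) (hx : ∀ t, x t = ((q t : Real.Angle), p t)) :
    (P.crossingTimes x T).Finite :=
  h.finite.subset fun s hs ↦ ⟨hs.1, cos_eq_one_of_mem_rotationSection (hx s ▸ hs.2)⟩

theorem IsMonotoneTransit.strictMonoOn_mul_stateNorm_sq {I W₁ W₂ T : ℝ} {q p : ℝ → ℝ}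
    {x : ℝ → State} (h : P.IsMonotoneTransit I q p W₁ W₂ T)
    (hx : ∀ t, x t = ((q t : Real.Angle), p t)) :
    StrictMonoOn (fun s ↦ I * stateNorm (x s) ^ 2) (P.crossingTimes x T) := by
  have hsection : ∀ s ∈ P.crossingTimes x T, Real.cos (q s) = 1 ∧
      P.levelSq (q s) (p s) = stateNorm (x s) ^ 2 := fun s hs ↦ by
    have hs' := hx s ▸ hs.2
    exact ⟨cos_eq_one_of_mem_rotationSection hs', hx s ▸ levelSq_eq_stateNorm_sq hs'⟩
  intro s hs t ht hst
  simpa only [(hsection s hs).2, (hsection t ht).2] using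
    h.strictMonoOn ⟨hs.1, (hsection s hs).1⟩ ⟨ht.1, (hsection t ht).1⟩ hst

theorem IsMonotoneTransit.isRotationGainingEnergy {I W₁ W₂ T : ℝ} {q p : ℝ → ℝ} {x : ℝ → State}
    (h : P.IsMonotoneTransit I q p W₁ W₂ T) (hx : ∀ t, x t = ((q t : Real.Angle), p t))
    (hI : 0 < I) : P.IsRotationGainingEnergy x T :=
  isRotationGainingEnergy_of_strictMonoOn (h.finite_crossingTimes hx) fun _ hs _ ht hst ↦
    lt_of_pow_lt_pow_left₀ 2 (Real.sqrt_nonneg _) <|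
      lt_of_mul_lt_mul_left (h.strictMonoOn_mul_stateNorm_sq hx hs ht hst) hI.le

theorem IsMonotoneTransit.isRotationLosingEnergy {I W₁ W₂ T : ℝ} {q p : ℝ → ℝ} {x : ℝ → State}
    (h : P.IsMonotoneTransit I q p W₁ W₂ T) (hx : ∀ t, x t = ((q t : Real.Angle), p t))
    (hI : I < 0) : P.IsRotationLosingEnergy x T :=
  isRotationLosingEnergy_of_strictAntiOn (h.finite_crossingTimes hx) fun _ hs _ ht hst ↦
    lt_of_pow_lt_pow_left₀ 2 (Real.sqrt_nonneg _) <|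
      (mul_lt_mul_left_of_neg hI).1 (h.strictMonoOn_mul_stateNorm_sq hx hs ht hst)

variable (P)

theorem exists_rotation_energy_drift {R₁ R₂ : ℝ} (hR₁ : P.Rbar < R₁) (hR : R₁ ≤ R₂)
    (hS : ∀ r ∈ Icc √(10 * P.m * P.l ^ 2 * R₁) √(10 * P.m * P.l ^ 2 * R₂), 0 < P.S r) :
    ∃ δ > 0, ∀ I ≠ 0, |I| < δ → ∀ x₀ ∈ P.energyBand R₁ R₂, ∀ x, P.IsSolution I x₀ x → ∃ T ≥ 0,
      (0 < I → x T ∈ P.energyLevel R₂ ∧ P.IsRotationGainingEnergy x T) ∧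
      (I < 0 → x T ∈ P.energyLevel R₁ ∧ P.IsRotationLosingEnergy x T) := by
  have hk : 0 < 10 * P.m * P.l ^ 2 := mul_pos (mul_pos (by norm_num) P.m_pos) (pow_pos P.l_pos 2)
  obtain ⟨δ, hδ, htransit⟩ := P.exists_isMonotoneTransit
    (P.criticalSq_eq_mul_Rbar ▸ mul_lt_mul_of_pos_left hR₁ hk)
    (mul_le_mul_of_nonneg_left hR hk.le)
    fun W hW ↦ hS _ ⟨Real.sqrt_le_sqrt hW.1, Real.sqrt_le_sqrt hW.2⟩
  refine ⟨δ, hδ, fun I hI hIδ x₀ hx₀ x hx ↦ ?_⟩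
  obtain ⟨rfl, q, p, hxqp, hqp⟩ := P.isSolution_iff_exists_isLiftedSolution.1 hx
  have hlevel : ∀ t, P.levelSq (q t) (p t) = 10 * P.m * P.l ^ 2 * P.energy (x t) := fun t ↦ by
    rw [hxqp, levelSq_eq_mul_energy]
  obtain ⟨T, hT⟩ := htransit I hI hIδ q p hqp <| hlevel 0 ▸
    ⟨mul_le_mul_of_nonneg_left hx₀.1 hk.le, mul_le_mul_of_nonneg_left hx₀.2 hk.le⟩
  exact ⟨T, hT.nonneg,
    fun hI ↦ ⟨mul_left_cancel₀ hk.ne' (hlevel T ▸ hT.levelSq_eq_of_pos hI),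
      hT.isRotationGainingEnergy hxqp hI⟩,
    fun hI ↦ ⟨mul_left_cancel₀ hk.ne' (hlevel T ▸ hT.levelSq_eq_of_neg hI),
      hT.isRotationLosingEnergy hxqp hI⟩⟩

end Crossings

end AcrobotParams

theorem mainTheorem2 (P : AcrobotParams) (R₁ R₂ : ℝ) (hR₁ : P.Rbar < R₁) (hR₂ : R₁ < R₂)
    (hS : ∃ ε : ℝ, 0 < ε ∧
      ∀ r ∈ Set.Icc (Real.sqrt (10 * P.m * P.l ^ 2 * R₁)) (Real.sqrt (10 * P.m * P.l ^ 2 * R₂)),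
        ε ≤ P.S r) :
    ∃ Istar : ℝ, 0 < Istar ∧
      (∀ I ∈ Set.Ioc 0 Istar, ∀ x₀ ∈ P.energyBand R₁ R₂,
        (∃! x : ℝ → AcrobotParams.State, P.IsSolution I x₀ x) ∧
        ∀ x : ℝ → AcrobotParams.State, P.IsSolution I x₀ x →
          ∃ T : ℝ, 0 ≤ T ∧ x T ∈ P.energyLevel R₂ ∧ P.IsRotationGainingEnergy x T) ∧
      (∀ I ∈ Set.Ico (-Istar) 0, ∀ x₀ ∈ P.energyBand R₁ R₂,
        (∃! x : ℝ → AcrobotParams.State, P.IsSolution I x₀ x) ∧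
        ∀ x : ℝ → AcrobotParams.State, P.IsSolution I x₀ x →
          ∃ T : ℝ, 0 ≤ T ∧ x T ∈ P.energyLevel R₁ ∧ P.IsRotationLosingEnergy x T) := by
  obtain ⟨ε, hε, hS⟩ := hS
  obtain ⟨δ, hδ, hdrift⟩ :=
    P.exists_rotation_energy_drift hR₁ hR₂.le fun r hr ↦ hε.trans_le (hS r hr)
  refine ⟨δ / 2, half_pos hδ, fun I hI x₀ hx₀ ↦ ⟨P.existsUnique_isSolution I x₀, fun x hx ↦ ?_⟩,
    fun I hI x₀ hx₀ ↦ ⟨P.existsUnique_isSolution I x₀, fun x hx ↦ ?_⟩⟩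
  · have hIδ : |I| < δ := abs_lt.2 ⟨by linarith [hI.1], by linarith [hI.2]⟩
    obtain ⟨T, hT, hgain, -⟩ := hdrift I hI.1.ne' hIδ x₀ hx₀ x hx
    exact ⟨T, hT, hgain hI.1⟩
  · have hIδ : |I| < δ := abs_lt.2 ⟨by linarith [hI.1], by linarith [hI.2]⟩
    obtain ⟨T, hT, -, hloss⟩ := hdrift I hI.2.ne hIδ x₀ hx₀ x hx
    exact ⟨T, hT, hloss hI.2⟩
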